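/- For a permutation $\sigma$ of $\{1,\dots,n\}$ let $\mathrm{exc}(\sigma)=|\{i : \sigma(i)>i\}|$ be its number of excedances and let $\mathrm{maj}(\sigma)$ be its major index, that is, the sum of all $i\in\{1,\dots,n-1\}$ with $\sigma(i)>\sigma(i+1)$. Put $$A_n^{\mathrm{maj},\mathrm{exc}}(q,t)=\sum_{\sigma\in S_n}q^{\mathrm{maj}(\sigma)}t^{\mathrm{exc}(\sigma)},\qquad A_n(t)=\sum_{\sigma\in S_n}t^{\mathrm{exc}(\sigma)},\qquad [d]_t=1+t+\cdots+t^{d-1},$$ so that $A_n(t)$ is the $n$-th Eulerian polynomial and $A_0^{\mathrm{maj},\mathrm{exc}}(q,t)=A_0(t)=1$. Let $d\ge 1$ and $k\ge 0$ be integers, let $n=dk$, and let $\omega_d\in\mathbb{C}$ be any primitive $d$-th root of unity. Then, as polynomials in $t$ over $\mathbb{C}$, $$A_n^{\mathrm{maj},\mathrm{exc}}(\omega_d,\,t\,\omega_d^{-1})=A_k(t)\,[d]_t^{\,k}.$$ -/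

import Mathlib

namespace QEulerian

/-- The excedance set of `σ ∈ S_n`. The position `i : Fin n` stands for `i + 1 ∈ {1, …, n}`;
the last position is never an excedance. -/
def excSet {n : ℕ} (σ : Equiv.Perm (Fin n)) : Finset (Fin n) :=
  Finset.univ.filter fun i => i < σ i

/-- The number of excedances. -/
def exc {n : ℕ} (σ : Equiv.Perm (Fin n)) : ℕ := (excSet σ).card

/-- The descent set of `σ ∈ S_n`: the positions, other than the last one, at which the one-line
word of `σ` goes down. The position `i : Fin n` stands for `i + 1 ∈ {1, …, n}`. -/
def desSet {n : ℕ} (σ : Equiv.Perm (Fin n)) : Finset (Fin n) :=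
  Finset.univ.filter fun i => ∃ h : (i : ℕ) + 1 < n, σ ⟨(i : ℕ) + 1, h⟩ < σ i

/-- The major index: the sum of the descents, positions being counted from `1`. -/
def maj {n : ℕ} (σ : Equiv.Perm (Fin n)) : ℕ := ∑ i ∈ desSet σ, ((i : ℕ) + 1)

/-- The joint generating polynomial `A_n^{maj,exc}(q, t) = ∑_{σ ∈ S_n} q^{maj σ} t^{exc σ}`,
where `q` is the variable of index `0` and `t` the variable of index `1`. -/
noncomputable def majExcPolynomial (n : ℕ) : MvPolynomial (Fin 2) ℤ :=
  ∑ σ : Equiv.Perm (Fin n), MvPolynomial.X 0 ^ maj σ * MvPolynomial.X 1 ^ exc σ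

/-- The Eulerian polynomial `A_n(t) = ∑_{σ ∈ S_n} t^{exc σ}`. -/
noncomputable def eulerianPolynomial (n : ℕ) : Polynomial ℤ :=
  ∑ σ : Equiv.Perm (Fin n), Polynomial.X ^ exc σ

/-- The `q`-analogue `[m]_q = 1 + q + ⋯ + q^{m-1}`. -/
def qNumber {R : Type*} [Semiring R] (m : ℕ) (q : R) : R := ∑ j ∈ Finset.range m, q ^ j

end QEulerian

/-!
For a permutation `σ` put a bar on every excedance letter of its one-line word and order the barred
letters before the unbarred ones. The major index of the barred word is `maj σ - exc σ`
(`sum_dexSet_add_exc`), so the left-hand side is `∑ q^{maj of the barred word} t^{exc}` at `q = ω`.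
By inclusion–exclusion this is a sum over cut sets `T ⊆ {1, …, n - 1}`, a cut at `p` having weight
`q^p` and a non-cut weight `1 - q^p`, of `∑ t^{exc σ}` over the `σ` whose barred word descends only
at cuts (`sum_maj_exc_eq`).

The inner sum depends only on the sizes `μ` of the blocks into which `T` divides the positions. Such
a `σ` is the stable sorting permutation of a labelling of the values by blocks and bars, and the
conditions on the labelling are local (`excSum_eq_sum_labels`). Hence the inner sum is the
coefficient of `X^μ` in a product of linear forms (`excSum_eq_blockCoeff`). Differentiating such a
product gives a three-term relation for splitting a singleton off a block (`blockCoeff_split`), and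
by induction the coefficient is `E(∏ P_{μ_c}(y))`. Here `E` is the linear functional `y^k ↦ A_k(t)`
and `∑ P_m(y) x^m = ((1 - t x) / (1 - x))^{y / (1 - t)}` (`blockCoeff_eq_umbral`).

It remains to sum `∏ P_{μ_c}(y)` over all cut sets. At a primitive `d`-th root of unity every
multiple of `d` is forced to be a cut, so for `n = d k` the sum is the `k`-th power of the one for
`n = d` (`cutPoly_mul`). The latter is `[d]_t y` (`cutPoly_of_isPrimitiveRoot`): up to the
factor `∏_{0<p<d} (1 - ω^p) = d` it is the discrepancy in degree `d` between `P(x) G(ω x)` and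
`G(x)` for a suitable power series `G`, which is found by comparing logarithmic derivatives.
Applying `E` to `([d]_t y)^k` gives `A_k(t) [d]_t^k`.
-/

namespace QEulerian

open Finset

/-! ### The barred word of a permutation -/

/-- The `i`-th letter of the word obtained from the one-line word of `σ` by putting a bar on the
excedance letters. Barred letters precede unbarred ones, so an unbarred letter is shifted by `n`. -/
def barredValue {n : ℕ} (σ : Equiv.Perm (Fin n)) (i : Fin n) : ℕ :=
  if i < σ i then σ i else n + σ i

/-- The descent set of the barred word of `σ`, positions being counted from `1`. -/
def dexSet {m : ℕ} (σ : Equiv.Perm (Fin (m + 1))) : Finset ℕ :=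
  (univ.filter fun i : Fin m => barredValue σ i.succ < barredValue σ i.castSucc).image
    fun i : Fin m => (i : ℕ) + 1

theorem dexSet_subset {m : ℕ} (σ : Equiv.Perm (Fin (m + 1))) : dexSet σ ⊆ Ico 1 (m + 1) := by
  intro p hp
  obtain ⟨i, -, rfl⟩ := mem_image.1 hp
  simp

theorem succ_mem_dexSet {m : ℕ} (σ : Equiv.Perm (Fin (m + 1))) (i : Fin m) :
    (i : ℕ) + 1 ∈ dexSet σ ↔ barredValue σ i.succ < barredValue σ i.castSucc := by
  simp [dexSet, Fin.val_inj]

theorem maj_eq_sum {m : ℕ} (σ : Equiv.Perm (Fin (m + 1))) :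
    maj σ = ∑ i : Fin m, if σ i.succ < σ i.castSucc then (i : ℕ) + 1 else 0 := by
  rw [maj, desSet, sum_filter, Fin.sum_univ_castSucc]
  have h : ∀ i : Fin m, (⟨(i : ℕ) + 1, by omega⟩ : Fin (m + 1)) = i.succ := fun i => rfl
  simp [h]

/-- Passing to the barred word lowers the major index by the number of excedances: descents are
lost or gained exactly where an excedance and a non-excedance are adjacent, and the resulting
correction telescopes along each run of excedances. -/
theorem sum_dexSet_add_exc {m : ℕ} (σ : Equiv.Perm (Fin (m + 1))) :
    ∑ p ∈ dexSet σ, p + exc σ = maj σ := by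
  let e : Fin (m + 1) → ℕ := fun i => if i < σ i then 1 else 0
  have hexc : exc σ = ∑ i, e i := by simp [exc, excSet, e]
  have hlast : e (Fin.last m) = 0 := by simp [e, Fin.le_last]
  have h1 : ∑ p ∈ dexSet σ, p
      = ∑ i : Fin m,
          if barredValue σ i.succ < barredValue σ i.castSucc then (i : ℕ) + 1 else 0 := by
    rw [dexSet, sum_image fun i _ j _ h => Fin.ext (Nat.add_right_cancel h), sum_filter]
  have h2 : ∑ i : Fin (m + 1), (i : ℕ) * e i = ∑ i : Fin m, ((i : ℕ) + 1) * e i.succ := by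
    rw [Fin.sum_univ_succ]; simp
  have h3 : ∑ i : Fin (m + 1), ((i : ℕ) + 1) * e i = ∑ i : Fin m, ((i : ℕ) + 1) * e i.castSucc := by
    rw [Fin.sum_univ_castSucc, hlast]; simp
  have h4 : ∑ i : Fin (m + 1), ((i : ℕ) + 1) * e i
      = ∑ i : Fin (m + 1), (i : ℕ) * e i + ∑ i, e i := by
    rw [← sum_add_distrib]; exact sum_congr rfl fun i _ => by ring
  have h5 : (∑ i : Fin m,
          if barredValue σ i.succ < barredValue σ i.castSucc then (i : ℕ) + 1 else 0)
        + ∑ i : Fin m, ((i : ℕ) + 1) * e i.castSucc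
      = (∑ i : Fin m, if σ i.succ < σ i.castSucc then (i : ℕ) + 1 else 0)
        + ∑ i : Fin m, ((i : ℕ) + 1) * e i.succ := by
    rw [← sum_add_distrib, ← sum_add_distrib]
    refine sum_congr rfl fun i _ => ?_
    have hne : (σ i.succ : ℕ) ≠ σ i.castSucc := by
      intro h
      have := σ.injective (Fin.ext h)
      simp [Fin.ext_iff] at this
    have b1 := (σ i.succ).isLt
    have b2 := (σ i.castSucc).isLt
    simp only [barredValue, e, Fin.lt_def, Fin.val_succ, Fin.val_castSucc]
    split_ifs <;> omega
  rw [maj_eq_sum, h1, hexc]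
  omega

/-- Inclusion–exclusion: if every `p ∈ U` is chosen independently with weight `f p`, the supersets
of `S` have total weight `∏ p ∈ S, f p`. -/
theorem prod_eq_sum_superset {R : Type*} [CommRing R] (f : ℕ → R) {S U : Finset ℕ} (h : S ⊆ U) :
    ∏ p ∈ S, f p
      = ∑ T ∈ U.powerset, if S ⊆ T then (∏ p ∈ T, f p) * ∏ p ∈ U \ T, (1 - f p) else 0 := by
  have key := Finset.prod_add f (fun p => if p ∈ S then 0 else 1 - f p) U
  have hl : ∏ p ∈ U, (f p + if p ∈ S then 0 else 1 - f p) = ∏ p ∈ S, f p := by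
    rw [← prod_subset h]
    · exact prod_congr rfl fun p hp => by simp [hp]
    · intro p _ hp; simp [hp]
  rw [← hl, key]
  refine sum_congr rfl fun T hT => ?_
  split_ifs with hS
  · congr 1
    refine prod_congr rfl fun p hp => ?_
    rw [if_neg fun hpS => (mem_sdiff.1 hp).2 (hS hpS)]
  · obtain ⟨p, hpS, hpT⟩ := not_subset.1 hS
    rw [prod_eq_zero (i := p) (mem_sdiff.2 ⟨h hpS, hpT⟩) (by simp [hpS]), mul_zero]

/-- `∑ t ^ exc σ` over the permutations whose barred word descends only at positions in `T`. -/
def excSum {K : Type*} [CommRing K] (m : ℕ) (t : K) (T : Finset ℕ) : K :=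
  ∑ σ : Equiv.Perm (Fin (m + 1)), if dexSet σ ⊆ T then t ^ exc σ else 0

theorem sum_maj_exc_eq {K : Type*} [Field K] (m : ℕ) (q t : K) (hq : q ≠ 0) :
    ∑ σ : Equiv.Perm (Fin (m + 1)), q ^ maj σ * (t * q⁻¹) ^ exc σ
      = ∑ T ∈ (Ico 1 (m + 1)).powerset,
          ((∏ p ∈ T, q ^ p) * ∏ p ∈ Ico 1 (m + 1) \ T, (1 - q ^ p)) * excSum m t T := by
  simp only [excSum, mul_sum]
  rw [sum_comm]
  refine sum_congr rfl fun σ _ => ?_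
  have h : q ^ maj σ * (t * q⁻¹) ^ exc σ = (∏ p ∈ dexSet σ, q ^ p) * t ^ exc σ := by
    rw [← sum_dexSet_add_exc, pow_add, prod_pow_eq_pow_sum, mul_pow, inv_pow]
    field_simp
  rw [h, prod_eq_sum_superset _ (dexSet_subset σ), sum_mul]
  refine sum_congr rfl fun T _ => ?_
  split_ifs <;> simp

/-! ### Blocks and labellings -/

/-- The first position of the block containing `i`, when the positions `0, 1, …` are cut before
each element of `T`. -/
def blockStart (T : Finset ℕ) (i : ℕ) : ℕ := (T.filter (· ≤ i)).sup id

theorem blockStart_le (T : Finset ℕ) (i : ℕ) : blockStart T i ≤ i :=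
  Finset.sup_le fun _ hp => (mem_filter.1 hp).2

theorem blockStart_mono (T : Finset ℕ) : Monotone (blockStart T) := fun _ _ hij =>
  Finset.sup_mono fun _ hp =>
    mem_filter.2 ⟨(mem_filter.1 hp).1, (mem_filter.1 hp).2.trans hij⟩

theorem blockStart_of_mem {T : Finset ℕ} {i : ℕ} (h : i ∈ T) : blockStart T i = i :=
  (blockStart_le T i).antisymm (Finset.le_sup (f := id) (mem_filter.2 ⟨h, le_rfl⟩))

theorem blockStart_succ_of_notMem {T : Finset ℕ} {i : ℕ} (h : i + 1 ∉ T) :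
    blockStart T (i + 1) = blockStart T i := by
  unfold blockStart
  congr 1
  ext p
  simp only [mem_filter, and_congr_right_iff]
  intro hp
  have : p ≠ i + 1 := fun e => h (e ▸ hp)
  omega

theorem blockStart_idem (T : Finset ℕ) (i : ℕ) :
    blockStart T (blockStart T i) = blockStart T i := by
  induction i with
  | zero => rw [Nat.le_zero.1 (blockStart_le T 0), Nat.le_zero.1 (blockStart_le T 0)]
  | succ i ih =>
    by_cases h : i + 1 ∈ T
    · rw [blockStart_of_mem h, blockStart_of_mem h]
    · rw [blockStart_succ_of_notMem h, ih]

/-- The sizes of the blocks of `{0, …, n - 1}`, indexed by their first positions. -/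
noncomputable def blockSizes (T : Finset ℕ) (n : ℕ) : ℕ →₀ ℕ :=
  ∑ i ∈ range n, Finsupp.single (blockStart T i) 1

/-- The labels `(a, true)` and `(a, false)`, which stand for the barred and the unbarred positions
in the block starting at `a`, are ordered by block, barred ones first. -/
def labelKey {n : ℕ} (l : Fin n × Bool) : ℕ := 2 * l.1 + if l.2 then 0 else 1

/-- The label `l` is admissible for the value `v`. A barred position in the block of `v` lies
strictly before `v`, so the first value of a block cannot be taken there. -/
def Admissible (T : Finset ℕ) {n : ℕ} (v : Fin n) (l : Fin n × Bool) : Prop :=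
  if l.2 then (l.1 : ℕ) ≤ blockStart T v ∧ l.1 ≠ v else blockStart T v ≤ l.1

instance (T : Finset ℕ) {n : ℕ} (v : Fin n) (l : Fin n × Bool) : Decidable (Admissible T v l) := by
  unfold Admissible; infer_instance

/-- The label of the position `i` of `σ`: its block, and whether it is an excedance. -/
def positionLabel (T : Finset ℕ) {n : ℕ} (σ : Equiv.Perm (Fin n)) (i : Fin n) : Fin n × Bool :=
  (⟨blockStart T i, (blockStart_le T i).trans_lt i.isLt⟩, decide (i < σ i))

theorem dexSet_subset_iff {m : ℕ} (T : Finset ℕ) (σ : Equiv.Perm (Fin (m + 1))) :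
    dexSet σ ⊆ T ↔
      StrictMono fun i => toLex (labelKey (positionLabel T σ i), σ i) := by
  rw [Fin.strictMono_iff_lt_succ]
  have h1 : dexSet σ ⊆ T ↔ ∀ i : Fin m, (i : ℕ) + 1 ∈ dexSet σ → (i : ℕ) + 1 ∈ T := by
    refine ⟨fun h i hi => h hi, fun h p hp => ?_⟩
    obtain ⟨i, -, rfl⟩ := mem_image.1 hp
    exact h i hp
  rw [h1]
  refine forall_congr' fun i => ?_
  rw [succ_mem_dexSet, Prod.Lex.toLex_lt_toLex]
  have hne : (σ i.succ : ℕ) ≠ σ i.castSucc := by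
    intro h
    have := σ.injective (Fin.ext h)
    simp [Fin.ext_iff] at this
  have b1 := (σ i.succ).isLt
  have b2 := (σ i.castSucc).isLt
  simp only [labelKey, positionLabel, barredValue, Fin.lt_def, Fin.val_succ, Fin.val_castSucc,
    decide_eq_true_eq]
  by_cases h : (i : ℕ) + 1 ∈ T
  · have h2 : blockStart T i ≤ i := blockStart_le T i
    simp only [h, blockStart_of_mem h, implies_true, true_iff]
    left
    split_ifs <;> omega
  · simp only [h, blockStart_succ_of_notMem h, imp_false]
    split_ifs <;> omega

theorem eq_sort_of_strictMono {m : ℕ} (T : Finset ℕ) (σ : Equiv.Perm (Fin m))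
    (h : StrictMono fun i => toLex (labelKey (positionLabel T σ i), σ i)) :
    σ = Tuple.sort fun v => labelKey (positionLabel T σ (σ.symm v)) := by
  rw [Tuple.eq_sort_iff]
  constructor
  · intro i j hij
    have := h.monotone hij
    simp only [Prod.Lex.toLex_le_toLex] at this
    simp only [Function.comp, Equiv.symm_apply_apply]
    rcases this with h | h
    · exact h.le
    · exact h.1.le
  · intro i j hij he
    have := h hij
    simp only [Prod.Lex.toLex_lt_toLex] at this
    simp only [Equiv.symm_apply_apply] at he
    rcases this with h | h
    · omega
    · exact h.2

theorem strictMono_sort {m : ℕ} (T : Finset ℕ) (l : Fin m → Fin m × Bool)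
    (h : ∀ i, l (Tuple.sort (labelKey ∘ l) i) = positionLabel T (Tuple.sort (labelKey ∘ l)) i) :
    StrictMono fun i => toLex (labelKey (positionLabel T (Tuple.sort (labelKey ∘ l)) i),
      Tuple.sort (labelKey ∘ l) i) := by
  obtain ⟨h1, h2⟩ := Tuple.eq_sort_iff.1 (rfl : Tuple.sort (labelKey ∘ l) = _)
  intro i j hij
  simp only [Prod.Lex.toLex_lt_toLex, ← h]
  rcases (h1 hij.le).lt_or_eq with h3 | h3
  · exact Or.inl h3
  · exact Or.inr ⟨h3, h2 i j hij h3⟩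

/-- Two weakly increasing words with the same content coincide. -/
theorem eq_of_monotone_of_content {m : ℕ} {f g : Fin m → ℕ} (hf : Monotone f) (hg : Monotone g)
    (h : ∑ i, Finsupp.single (f i) 1 = ∑ i, (Finsupp.single (g i) 1 : ℕ →₀ ℕ)) : f = g := by
  have hc : univ.val.map f = univ.val.map g := by
    have key : ∀ w : Fin m → ℕ,
        Finsupp.toMultiset (∑ i, (Finsupp.single (w i) 1 : ℕ →₀ ℕ)) = univ.val.map w := by
      intro w
      simp only [map_sum, Finsupp.toMultiset_single, one_smul]
      rw [← Multiset.sum_map_singleton (univ.val.map w), Multiset.map_map]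
      rfl
    rw [← key, ← key, h]
  have hl : List.ofFn f = List.ofFn g := by
    refine List.Perm.eq_of_pairwise' (r := (· ≤ ·)) ?_ ?_ ?_
    · exact List.pairwise_ofFn.2 fun _ _ hij => hf hij.le
    · exact List.pairwise_ofFn.2 fun _ _ hij => hg hij.le
    · rw [← Multiset.coe_eq_coe, ← Fin.univ_val_map, ← Fin.univ_val_map, hc]
  exact List.ofFn_injective hl

theorem fst_sort {m : ℕ} (T : Finset ℕ) (l : Fin m → Fin m × Bool)
    (h : ∑ v, Finsupp.single ((l v).1 : ℕ) 1 = blockSizes T m) (i : Fin m) :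
    ((l (Tuple.sort (labelKey ∘ l) i)).1 : ℕ) = blockStart T i := by
  refine congrFun (eq_of_monotone_of_content (f := fun i => (l (Tuple.sort (labelKey ∘ l) i)).1)
    (g := fun i => blockStart T i) ?_ ?_ ?_) i
  · intro i j hij
    have := Tuple.monotone_sort (labelKey ∘ l) hij
    simp only [Function.comp, labelKey] at this
    show ((l _).1 : ℕ) ≤ (l _).1
    split_ifs at this <;> omega
  · exact fun i j hij => blockStart_mono T hij
  · rw [Equiv.sum_comp (Tuple.sort (labelKey ∘ l))
      (fun v => (Finsupp.single ((l v).1 : ℕ) 1 : ℕ →₀ ℕ)), h, blockSizes,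
      ← Fin.sum_univ_eq_sum_range (fun i => (Finsupp.single (blockStart T i) 1 : ℕ →₀ ℕ))]

/-- Sorting an admissible labelling with the right content gives a permutation whose barred
positions are exactly those labelled as such. Within one block and one kind of label the values
increase, so a single misplaced value would force the next one towards the end of the block to be
misplaced as well. -/
theorem apply_sort {m : ℕ} (T : Finset ℕ) (l : Fin m → Fin m × Bool)
    (hadm : ∀ v, Admissible T v (l v))
    (h : ∑ v, Finsupp.single ((l v).1 : ℕ) 1 = blockSizes T m) (i : Fin m) :
    l (Tuple.sort (labelKey ∘ l) i) = positionLabel T (Tuple.sort (labelKey ∘ l)) i := by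
  obtain ⟨h1, h2⟩ := Tuple.eq_sort_iff.1 (rfl : Tuple.sort (labelKey ∘ l) = _)
  have hfst := fst_sort T l h
  set σ := Tuple.sort (labelKey ∘ l) with hσ
  have hmono : ∀ i j, i ≤ j → labelKey (l (σ i)) ≤ labelKey (l (σ j)) := fun i j hij => h1 hij
  have htie : ∀ i j, i < j → labelKey (l (σ i)) = labelKey (l (σ j)) → σ i < σ j := h2
  simp only [labelKey, hfst] at hmono htie
  have hadm' : ∀ i, if (l (σ i)).2 then
      blockStart T i ≤ blockStart T (σ i) ∧ blockStart T i ≠ σ i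
      else blockStart T (σ i) ≤ blockStart T i := by
    intro i
    have := hadm (σ i)
    simp only [Admissible, ne_eq, Fin.ext_iff, hfst] at this
    exact this
  have htrue : ∀ k : ℕ, ∀ i : Fin m, (i : ℕ) = k → (l (σ i)).2 = true → i < σ i := by
    intro k
    induction k using Nat.strong_induction_on with
    | _ k ih =>
      rintro i rfl hi
      by_contra hlt
      have ha := hadm' i
      rw [if_pos hi] at ha
      have hle : σ i ≤ i := not_lt.1 hlt
      have hb : blockStart T (σ i) = blockStart T i := (blockStart_mono T hle).antisymm ha.1
      -- earlier positions of the block carry the same label, so they are excedances by induction,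
      -- with smaller values
      have step : ∀ j : Fin m, j < i → blockStart T j = blockStart T i → j < σ j ∧ σ j < σ i := by
        intro j hj hbj
        have hm := hmono j i hj.le
        have ht := htie j i hj
        rw [hbj] at hm ht
        rw [if_pos hi] at hm ht
        have hjt : (l (σ j)).2 = true := by
          by_contra hf
          rw [if_neg hf] at hm
          omega
        exact ⟨ih j hj j rfl hjt, ht (by rw [if_pos hjt])⟩
      rcases hle.lt_or_eq with hlt' | heq
      · have := step (σ i) hlt' hb
        exact absurd (this.1.trans this.2) (lt_irrefl _)
      · have hai : blockStart T i < i := lt_of_le_of_ne (blockStart_le T i) fun e =>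
          ha.2 (e.trans (congrArg Fin.val heq).symm)
        have hb' : blockStart T ((i : ℕ) - 1) = blockStart T i := by
          refine (blockStart_mono T (by omega)).antisymm ?_
          conv_lhs => rw [← blockStart_idem]
          exact blockStart_mono T (by omega)
        have := step ⟨(i : ℕ) - 1, by omega⟩ (Fin.lt_def.2 (by simp only; omega)) hb'
        rw [heq, Fin.lt_def, Fin.lt_def] at this
        simp only at this
        omega
  have hfalse : ∀ k : ℕ, ∀ i : Fin m, m - (i : ℕ) = k → (l (σ i)).2 = false → σ i ≤ i := by
    intro k
    induction k using Nat.strong_induction_on with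
    | _ k ih =>
      rintro i rfl hi
      by_contra hlt
      have hlt : i < σ i := not_le.1 hlt
      have ha := hadm' i
      rw [if_neg (by simp [hi])] at ha
      have hb : blockStart T (σ i) = blockStart T i :=
        ha.antisymm (blockStart_mono T hlt.le)
      have hm := hmono i (σ i) hlt.le
      have ht := htie i (σ i) hlt
      rw [hb] at hm ht
      have hjf : (l (σ (σ i))).2 = false := by
        by_contra hf
        rw [if_neg (by simp [hi]), if_pos (by simpa using hf)] at hm
        omega
      have := ih (m - (σ i : ℕ)) (by have := (σ i).isLt; have := Fin.lt_def.1 hlt; omega)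
        (σ i) rfl hjf
      exact absurd (ht (by simp [hi, hjf])) (not_lt.2 this)
  refine Prod.ext (Fin.ext (hfst i)) ?_
  simp only [positionLabel]
  by_cases hb : (l (σ i)).2 = true
  · rw [hb]; exact (decide_eq_true (htrue _ i rfl hb)).symm
  · have hb : (l (σ i)).2 = false := by simpa using hb
    rw [hb]; exact (decide_eq_false (not_lt.2 (hfalse _ i rfl hb))).symm

/-- Permutations whose barred word descends only at `T` correspond to admissible labellings of
the values: label each value by its position, and recover the permutation by stable sorting. -/
theorem excSum_eq_sum_labels {K : Type*} [CommRing K] (m : ℕ) (t : K) (T : Finset ℕ) :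
    excSum m t T = ∑ l : Fin (m + 1) → Fin (m + 1) × Bool,
      if (∀ v, Admissible T v (l v)) ∧
          ∑ v, Finsupp.single ((l v).1 : ℕ) 1 = blockSizes T (m + 1) then
        ∏ v, (if (l v).2 then t else 1) else 0 := by
  classical
  rw [excSum, ← sum_filter, ← sum_filter]
  refine sum_nbij' (fun σ v => positionLabel T σ (σ.symm v))
    (fun l => Tuple.sort (labelKey ∘ l)) ?_ ?_ ?_ ?_ ?_
  · intro σ _
    rw [mem_filter]
    refine ⟨mem_univ _, fun v => ?_, ?_⟩
    · obtain ⟨i, rfl⟩ := σ.surjective v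
      simp only [Admissible, positionLabel, Equiv.symm_apply_apply, decide_eq_true_eq, ne_eq,
        Fin.ext_iff]
      split_ifs with hi
      · exact ⟨blockStart_mono T hi.le, ((blockStart_le T i).trans_lt hi).ne⟩
      · exact blockStart_mono T (not_lt.1 hi)
    · rw [Equiv.sum_comp σ.symm
        (fun i => (Finsupp.single ((positionLabel T σ i).1 : ℕ) 1 : ℕ →₀ ℕ))]
      exact Fin.sum_univ_eq_sum_range (fun i => (Finsupp.single (blockStart T i) 1 : ℕ →₀ ℕ)) _
  · intro l hl
    obtain ⟨-, hl1, hl2⟩ := mem_filter.1 hl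
    exact mem_filter.2 ⟨mem_univ _,
      (dexSet_subset_iff T _).2 (strictMono_sort T l (apply_sort T l hl1 hl2))⟩
  · intro σ hσ
    exact (eq_sort_of_strictMono T σ ((dexSet_subset_iff T σ).1 (mem_filter.1 hσ).2)).symm
  · intro l hl
    obtain ⟨-, hl1, hl2⟩ := mem_filter.1 hl
    funext v
    rw [← apply_sort T l hl1 hl2, Equiv.apply_symm_apply]
  · intro σ _
    rw [Equiv.prod_comp σ.symm (fun i => if (positionLabel T σ i).2 then t else 1),
      prod_ite, prod_const, prod_const_one, mul_one]
    simp [exc, excSet, positionLabel]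

/-! ### The block coefficient -/

section BlockCoefficient

variable {K : Type*} [CommRing K]

/-- The linear form `t ∑_{a < c} X_a + ∑_{c ≤ a < n} X_a`: the labels, summed by block, which
are admissible for the first value `c` of a block. -/
noncomputable def firstForm (n : ℕ) (t : K) (c : ℕ) : MvPolynomial ℕ K :=
  ∑ a ∈ range n, MvPolynomial.C (if a < c then t else 1) * MvPolynomial.X a

/-- The linear form `t ∑_{a ≤ c} X_a + ∑_{c ≤ a < n} X_a`: the labels, summed by block, which
are admissible for the other values of the block starting at `c`. -/
noncomputable def otherForm (n : ℕ) (t : K) (c : ℕ) : MvPolynomial ℕ K :=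
  firstForm n t c + MvPolynomial.C t * MvPolynomial.X c

/-- The product of the linear forms of a block of size `k` which starts at `c`. -/
noncomputable def blockFactor (n : ℕ) (t : K) (c k : ℕ) : MvPolynomial ℕ K :=
  if k = 0 then 1 else firstForm n t c * otherForm n t c ^ (k - 1)

/-- The coefficient of `X ^ μ` in the product of the linear forms of all blocks, the block which
starts at `c` having size `μ c`. -/
noncomputable def blockCoeff (n : ℕ) (t : K) (μ : ℕ →₀ ℕ) : K :=
  (∏ c ∈ range n, blockFactor n t c (μ c)).coeff μ

theorem prod_monomial {ι σ : Type*} (s : Finset ι) (f : ι → σ →₀ ℕ) (g : ι → K) :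
    ∏ i ∈ s, MvPolynomial.monomial (f i) (g i)
      = MvPolynomial.monomial (∑ i ∈ s, f i) (∏ i ∈ s, g i) := by
  classical
  induction s using Finset.induction_on with
  | empty => simp
  | insert a s ha ih => rw [prod_insert ha, sum_insert ha, prod_insert ha, ih,
      MvPolynomial.monomial_mul]

theorem sum_admissible (n : ℕ) (t : K) (T : Finset ℕ) (v : Fin n) :
    ∑ l : Fin n × Bool, MvPolynomial.monomial (Finsupp.single (l.1 : ℕ) 1)
        (if Admissible T v l then (if l.2 then t else 1) else 0)
      = if (v : ℕ) = blockStart T v then firstForm n t (blockStart T v)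
        else otherForm n t (blockStart T v) := by
  have hc := blockStart_le T v
  have hn := v.isLt
  generalize hcdef : blockStart T v = c at hc
  have hX : MvPolynomial.C t * MvPolynomial.X c
      = ∑ a ∈ range n,
          MvPolynomial.C (if a = c then t else 0) * (MvPolynomial.X a : MvPolynomial ℕ K) := by
    rw [sum_eq_single c]
    · simp
    · intro a _ ha; simp [ha]
    · intro h; exact absurd (mem_range.2 (by omega)) h
  have hl : ∑ l : Fin n × Bool, MvPolynomial.monomial (Finsupp.single (l.1 : ℕ) 1)
        (if Admissible T v l then (if l.2 then t else 1) else 0)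
      = ∑ a ∈ range n, MvPolynomial.C ((if a ≤ c ∧ a ≠ v then t else 0) + if c ≤ a then 1 else 0)
          * (MvPolynomial.X a : MvPolynomial ℕ K) := by
    rw [Fintype.sum_prod_type, ← Fin.sum_univ_eq_sum_range (fun a =>
      MvPolynomial.C ((if a ≤ c ∧ a ≠ (v : ℕ) then t else 0) + if c ≤ a then 1 else 0)
          * (MvPolynomial.X a : MvPolynomial ℕ K))]
    refine sum_congr rfl fun a _ => ?_
    rw [Fintype.sum_bool, ← map_add, MvPolynomial.C_mul_X_eq_monomial]
    simp [Admissible, hcdef, Fin.ext_iff]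
  rw [hl]
  split_ifs with h
  · refine sum_congr rfl fun a _ => ?_
    congr 2
    split_ifs <;> first | omega | simp
  · rw [otherForm, hX, firstForm, ← sum_add_distrib]
    refine sum_congr rfl fun a _ => ?_
    rw [← add_mul, ← map_add]
    congr 2
    split_ifs <;> first | omega | simp [add_comm]

theorem blockSizes_apply (T : Finset ℕ) (n c : ℕ) :
    blockSizes T n c = ((range n).filter fun v => blockStart T v = c).card := by
  rw [blockSizes, Finsupp.finsetSum_apply, card_filter]
  exact sum_congr rfl fun v _ => by rw [Finsupp.single_apply]

theorem prod_forms_eq (n : ℕ) (t : K) (T : Finset ℕ) :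
    ∏ v : Fin n, (if (v : ℕ) = blockStart T v then firstForm n t (blockStart T v)
        else otherForm n t (blockStart T v))
      = ∏ c ∈ range n, blockFactor n t c (blockSizes T n c) := by
  rw [Fin.prod_univ_eq_prod_range (fun v => if v = blockStart T v then
    firstForm n t (blockStart T v) else otherForm n t (blockStart T v)),
    ← prod_fiberwise_of_maps_to (t := range n) (g := blockStart T)
      (fun v hv => mem_range.2 ((blockStart_le T v).trans_lt (mem_range.1 hv)))]
  refine prod_congr rfl fun c hc => ?_
  rw [blockSizes_apply, blockFactor]
  split_ifs with h0
  · rw [card_eq_zero.1 h0, prod_empty]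
  · obtain ⟨v, hv⟩ := card_pos.1 (Nat.pos_of_ne_zero h0)
    have hcc : blockStart T c = c := by
      rw [← (mem_filter.1 hv).2, blockStart_idem]
    have hmem : c ∈ (range n).filter fun v => blockStart T v = c := mem_filter.2 ⟨hc, hcc⟩
    rw [← mul_prod_erase _ _ hmem, hcc, if_pos rfl, ← card_erase_of_mem hmem]
    congr 1
    refine prod_eq_pow_card fun v hv => ?_
    obtain ⟨h1, h2⟩ := mem_erase.1 hv
    rw [(mem_filter.1 h2).2, if_neg h1]

/-- The excedance sums attached to `T` are block coefficients. -/
theorem excSum_eq_blockCoeff (m : ℕ) (t : K) (T : Finset ℕ) :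
    excSum m t T = blockCoeff (m + 1) t (blockSizes T (m + 1)) := by
  classical
  rw [excSum_eq_sum_labels, blockCoeff, ← prod_forms_eq]
  simp only [← sum_admissible]
  rw [prod_univ_sum, Fintype.piFinset_univ, MvPolynomial.coeff_sum]
  refine sum_congr rfl fun l _ => ?_
  rw [prod_monomial, MvPolynomial.coeff_monomial, prod_ite_zero]
  simp only [mem_univ, true_implies]
  split_ifs <;> simp_all

end BlockCoefficient

/-! ### Splitting off a singleton block -/

section Splitting

open MvPolynomial

variable {K : Type*} [CommRing K]

theorem pderiv_firstForm {n a : ℕ} (ha : a < n) (t : K) (b : ℕ) :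
    pderiv a (firstForm n t b) = C (if a < b then t else 1) := by
  rw [firstForm, map_sum, sum_eq_single a]
  · simp [Derivation.leibniz]
  · intro b' _ hb'
    simp [Derivation.leibniz, hb']
  · intro h; exact absurd (mem_range.2 ha) h

theorem pderiv_otherForm {n a : ℕ} (ha : a < n) (t : K) (b : ℕ) :
    pderiv a (otherForm n t b)
      = C (if a < b then t else 1) + if a = b then C t else 0 := by
  rw [otherForm, map_add, pderiv_firstForm ha]
  congr 1
  rw [Derivation.leibniz]
  split_ifs with h
  · simp [h]
  · simp [pderiv_X_of_ne (Ne.symm h)]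

theorem blockFactor_zero (n : ℕ) (t : K) (c : ℕ) : blockFactor n t c 0 = 1 := if_pos rfl

theorem blockFactor_succ (n : ℕ) (t : K) (c k : ℕ) :
    blockFactor n t c (k + 1) = firstForm n t c * otherForm n t c ^ k := by
  simp [blockFactor]

theorem natCast_mul_blockFactor (n : ℕ) (t : K) (c k : ℕ) :
    (k : MvPolynomial ℕ K) * blockFactor n t c k
      = firstForm n t c * (k * otherForm n t c ^ (k - 1)) := by
  cases k with
  | zero => simp
  | succ k => rw [blockFactor_succ, Nat.add_sub_cancel]; ring

theorem prod_apply_add_single {M : Type*} [CommMonoid M] (g : ℕ → ℕ → M) (hg : ∀ b, g b 0 = 1)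
    {n : ℕ} {μ : ℕ →₀ ℕ} {c : ℕ} (hc : c < n) (h : μ c = 0) (k : ℕ) :
    ∏ b ∈ range n, g b ((μ + Finsupp.single c k) b)
      = (∏ b ∈ range n, g b (μ b)) * g c k := by
  rw [← mul_prod_erase _ _ (mem_range.2 hc), ← mul_prod_erase (range n) _ (mem_range.2 hc), h,
    hg, one_mul, mul_comm]
  congr 1
  · refine prod_congr rfl fun b hb => ?_
    rw [Finsupp.add_apply, Finsupp.single_eq_of_ne (ne_of_mem_erase hb), add_zero]
  · rw [Finsupp.add_apply, Finsupp.single_eq_same, h, zero_add]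

theorem prod_blockFactor_add_single {n : ℕ} (t : K) {μ : ℕ →₀ ℕ} {c : ℕ} (hc : c < n)
    (h : μ c = 0) (k : ℕ) :
    ∏ b ∈ range n, blockFactor n t b ((μ + Finsupp.single c k) b)
      = (∏ b ∈ range n, blockFactor n t b (μ b)) * blockFactor n t c k :=
  prod_apply_add_single _ (blockFactor_zero n t) hc h k

/-- The forms of the other blocks do not distinguish two labels between which no block starts. -/
theorem pderiv_prod_blockFactor_eq {n : ℕ} (t : K) {μ : ℕ →₀ ℕ} {c c' : ℕ} (hcc : c < c')
    (hc' : c' < n) (h : ∀ a, c ≤ a → a ≤ c' → μ a = 0) :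
    pderiv c (∏ b ∈ range n, blockFactor n t b (μ b))
      = pderiv c' (∏ b ∈ range n, blockFactor n t b (μ b)) := by
  refine prod_induction _ (fun p => pderiv c p = pderiv c' p) ?_ ?_ ?_
  · intro p q hp hq
    rw [Derivation.leibniz, Derivation.leibniz, hp, hq]
  · rw [Derivation.map_one_eq_zero, Derivation.map_one_eq_zero]
  · intro b _
    by_cases hb : c ≤ b ∧ b ≤ c'
    · rw [h b hb.1 hb.2, blockFactor_zero, Derivation.map_one_eq_zero,
        Derivation.map_one_eq_zero]
    · have hiff : c < b ↔ c' < b := by omega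
      have h1 : c ≠ b := by omega
      have h2 : c' ≠ b := by omega
      have hf : pderiv c (firstForm n t b) = pderiv c' (firstForm n t b) := by
        rw [pderiv_firstForm (hcc.trans hc'), pderiv_firstForm hc']
        simp [hiff]
      have ho : pderiv c (otherForm n t b) = pderiv c' (otherForm n t b) := by
        rw [pderiv_otherForm (hcc.trans hc'), pderiv_otherForm hc']
        simp [hiff, h1, h2]
      rw [blockFactor]
      split_ifs
      · rw [Derivation.map_one_eq_zero, Derivation.map_one_eq_zero]
      · rw [Derivation.leibniz, Derivation.leibniz, Derivation.leibniz_pow,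
          Derivation.leibniz_pow, hf, ho]

theorem coeff_mul_X_eq_zero {μ : ℕ →₀ ℕ} {a : ℕ} (h : μ a = 0) (p : MvPolynomial ℕ K) :
    coeff μ (p * X a) = 0 := by
  classical
  rw [coeff_mul_X', if_neg (by simpa using h)]

/-- Euler's identity for a single variable. -/
theorem coeff_X_mul_pderiv (μ : ℕ →₀ ℕ) (c : ℕ) (p : MvPolynomial ℕ K) :
    coeff μ (X c * pderiv c p) = μ c * coeff μ p := by
  classical
  rw [coeff_X_mul']
  split_ifs with h
  · have h1 : 1 ≤ μ c := Nat.one_le_iff_ne_zero.2 (by simpa using h)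
    have hle : Finsupp.single c 1 ≤ μ := Finsupp.single_le_iff.2 h1
    rw [coeff_pderiv, tsub_add_cancel_of_le hle, Finsupp.tsub_apply, Finsupp.single_eq_same,
      ← Nat.cast_add_one, Nat.sub_add_cancel h1, mul_comm]
  · rw [show μ c = 0 by simpa using h]; simp

theorem firstForm_eq_sub {n : ℕ} (t : K) {c c' : ℕ} (hcc : c < c') (hc' : c' < n) :
    firstForm n t c' = otherForm n t c - X c + ∑ a ∈ Ioo c c', C (t - 1) * X a := by
  have h1 : ∀ f : ℕ → MvPolynomial ℕ K,
      ∑ a ∈ Ioo c c', f a = ∑ a ∈ range n, if c < a ∧ a < c' then f a else 0 := by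
    intro f
    rw [← sum_filter]
    refine sum_congr ?_ fun _ _ => rfl
    ext a
    simp only [mem_Ioo, mem_filter, mem_range]
    omega
  have h2 : (C (t - 1) * X c : MvPolynomial ℕ K)
      = ∑ a ∈ range n, if a = c then C (t - 1) * X a else 0 := by
    rw [sum_ite_eq', if_pos (mem_range.2 (hcc.trans hc'))]
  have h3 : otherForm n t c - X c = firstForm n t c + C (t - 1) * X c := by
    rw [otherForm, map_sub, C_1]; ring
  rw [h1, h3, h2, firstForm, firstForm, ← sum_add_distrib, ← sum_add_distrib]
  refine sum_congr rfl fun a _ => ?_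
  have h4 : ∀ x : K, C 1 * X a + C (x - 1) * X a = (C x * X a : MvPolynomial ℕ K) := by
    intro x; rw [← add_mul, ← map_add]; congr 2; ring
  split_ifs <;> first | omega | simp [← h4 t]

/-- The three-term relation which splits a singleton block off a block of size `m + 1`. -/
theorem blockCoeff_split {n : ℕ} (t : K) {μ : ℕ →₀ ℕ} {c c' : ℕ} (hcc : c < c')
    (hc' : c' < n) (h : ∀ a, c ≤ a → a ≤ c' → μ a = 0) (k : ℕ) :
    ((k : K) + 2) * blockCoeff n t (μ + Finsupp.single c (k + 2))
      = blockCoeff n t (μ + Finsupp.single c (k + 1) + Finsupp.single c' 1)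
        + (1 + t) * (k + 1) * blockCoeff n t (μ + Finsupp.single c (k + 1))
        - t * k * blockCoeff n t (μ + Finsupp.single c k) := by
  have hc : c < n := hcc.trans hc'
  have hμc : μ c = 0 := h c le_rfl hcc.le
  have hμc' : μ c' = 0 := h c' hcc.le le_rfl
  set ν := μ + Finsupp.single c (k + 1) with hν
  have hνc : ν c = k + 1 := by simp [hν, hμc]
  have hνc' : ν c' = 0 := by simp [hν, hμc', hcc.ne]
  have hνa : ∀ a ∈ Ioo c c', ν a = 0 := by
    intro a ha
    obtain ⟨h1, h2⟩ := mem_Ioo.1 ha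
    simp [hν, h a h1.le h2.le, h1.ne]
  set F := ∏ b ∈ range n, blockFactor n t b (μ b) with hF
  set R := firstForm n t c with hR
  set L := otherForm n t c with hL
  have hδF : pderiv c' F = pderiv c F := (pderiv_prod_blockFactor_eq t hcc hc' h).symm
  have hdR : pderiv c R = 1 := by rw [hR, pderiv_firstForm hc]; simp
  have hδR : pderiv c' R = 1 := by rw [hR, pderiv_firstForm hc']; simp [hcc.not_gt]
  have hdL : pderiv c L = 1 + C t := by rw [hL, pderiv_otherForm hc]; simp
  have hδL : pderiv c' L = 1 := by rw [hL, pderiv_otherForm hc']; simp [hcc.not_gt, hcc.ne']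
  have hδX : pderiv c' (X c : MvPolynomial ℕ K) = 0 := pderiv_X_of_ne hcc.ne
  set Q : MvPolynomial ℕ K := k * L ^ (k - 1) with hQ
  have hQL : Q * L = k * L ^ k := by
    cases k with
    | zero => simp [hQ]
    | succ k => rw [hQ, Nat.add_sub_cancel]; ring
  have hdP : ∀ D : Derivation K (MvPolynomial ℕ K) (MvPolynomial ℕ K), D (L ^ k) = Q * D L := by
    intro D
    rw [Derivation.leibniz_pow, hQ, smul_eq_mul, nsmul_eq_mul, mul_assoc]
  have e1 : ((k : K) + 2) * blockCoeff n t (μ + Finsupp.single c (k + 2))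
      = coeff ν (pderiv c (F * (R * (L ^ k * L)))) := by
    rw [coeff_pderiv, hνc, blockCoeff, prod_blockFactor_add_single t hc hμc, ← hF,
      blockFactor_succ, ← hR, ← hL, pow_succ, hν, add_assoc, ← Finsupp.single_add]
    push_cast
    ring_nf
  have e2 : blockCoeff n t (ν + Finsupp.single c' 1)
      = coeff ν (pderiv c' (F * (R * (L ^ k * (L - X c))))) := by
    -- no block starts strictly between `c` and `c'`, so those variables do not contribute
    have hG : ∀ G : MvPolynomial ℕ K, coeff ν (pderiv c' (G * ∑ a ∈ Ioo c c', C (t - 1) * X a))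
        = 0 := by
      intro G
      rw [mul_sum, map_sum, coeff_sum]
      refine sum_eq_zero fun a ha => ?_
      rw [← mul_assoc, Derivation.leibniz, pderiv_X_of_ne (mem_Ioo.1 ha).2.ne, smul_zero, zero_add,
        smul_eq_mul, mul_comm, coeff_mul_X_eq_zero (hνa a ha)]
    have hsplit : F * (R * L ^ k) * firstForm n t c' = F * (R * (L ^ k * (L - X c)))
        + F * (R * L ^ k) * ∑ a ∈ Ioo c c', C (t - 1) * X a := by
      rw [firstForm_eq_sub t hcc hc']; ring
    rw [blockCoeff, prod_blockFactor_add_single t hc' hνc', hν,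
      prod_blockFactor_add_single t hc hμc, ← hF, ← hν, blockFactor_succ, blockFactor_succ, ← hR,
      ← hL, pow_zero, mul_one, hsplit,
      ← add_zero (coeff ν _), ← hG (F * (R * L ^ k)), ← coeff_add, ← map_add, coeff_pderiv, hνc']
    simp
  have e3 : blockCoeff n t ν = coeff ν (F * (R * L ^ k)) := by
    rw [blockCoeff, hν, prod_blockFactor_add_single t hc hμc, blockFactor_succ]
  have e4 : (k : K) * blockCoeff n t (μ + Finsupp.single c k) = coeff ν (X c * (F * (R * Q))) := by
    have hs : ν = Finsupp.single c 1 + (μ + Finsupp.single c k) := by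
      rw [hν, Finsupp.single_add]; abel
    rw [hs, coeff_X_mul, blockCoeff, prod_blockFactor_add_single t hc hμc, ← coeff_C_mul, ← hF,
      map_natCast, mul_left_comm, natCast_mul_blockFactor]
  have e5 := coeff_X_mul_pderiv ν c (F * (R * L ^ k))
  -- the difference of the two sides of the relation, before taking coefficients; the coefficient
  -- of `X ^ ν` on the right vanishes by Euler's identity
  have key : pderiv c' (F * (R * (L ^ k * (L - X c)))) - pderiv c (F * (R * (L ^ k * L)))
      + C ((1 + t) * (k + 1)) * (F * (R * L ^ k)) - C t * (X c * (F * (R * Q)))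
      = C ((k : K) + 1) * (F * (R * L ^ k)) - X c * pderiv c (F * (R * L ^ k)) := by
    simp only [Derivation.leibniz, hdP, map_sub, hδF, hdR, hδR, hdL, hδL, hδX, smul_eq_mul, C_add,
      C_mul, C_1, map_natCast]
    linear_combination (F * R * (1 : MvPolynomial ℕ K) - F * R * (1 + C t)) * hQL
  have hkey := congrArg (coeff ν) key
  rw [coeff_sub, coeff_sub, coeff_add, coeff_sub, coeff_C_mul, coeff_C_mul, coeff_C_mul, e5, hνc,
    ← e1, ← e2, ← e3, ← e4] at hkey
  push_cast at hkey
  linear_combination -hkey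

end Splitting

/-! ### Umbral evaluation of the block coefficients -/

section Umbral

/-- The value `A_k(t)` of the Eulerian polynomial. -/
def eulerianValue {K : Type*} [CommRing K] (t : K) (k : ℕ) : K :=
  ∑ σ : Equiv.Perm (Fin k), t ^ exc σ

theorem firstForm_eq_sum_monomial {K : Type*} [CommRing K] (n : ℕ) (t : K) (c : ℕ) :
    firstForm n t c = ∑ a ∈ range n,
      MvPolynomial.monomial (Finsupp.single a 1) (if a < c then t else 1) :=
  sum_congr rfl fun _ _ => MvPolynomial.C_mul_X_eq_monomial

/-- If all blocks are singletons, the block coefficient is a permanent which enumerates the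
permutations of the set of blocks by excedances. -/
theorem blockCoeff_of_le_one {K : Type*} [CommRing K] {n : ℕ} (t : K) {μ : ℕ →₀ ℕ}
    (hn : ∀ c, μ c ≠ 0 → c < n) (h : ∀ c, μ c ≤ 1) :
    blockCoeff n t μ = eulerianValue t μ.support.card := by
  classical
  set S := μ.support with hS
  have hmemS : ∀ c, c ∈ S ↔ μ c ≠ 0 := fun c => Finsupp.mem_support_iff
  have hone : ∀ c ∈ S, μ c = 1 := by
    intro c hc
    have := h c
    have := (hmemS c).1 hc
    omega
  have hprod : ∏ c ∈ range n, blockFactor n t c (μ c) = ∏ c ∈ S, firstForm n t c := by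
    have hsub : S ⊆ range n := fun c hc => mem_range.2 (hn c ((hmemS c).1 hc))
    rw [← prod_subset hsub]
    · refine prod_congr rfl fun c hc => ?_
      rw [hone c hc, blockFactor_succ, pow_zero, mul_one]
    · intro c _ hc
      rw [not_not.1 (mt (hmemS c).2 hc), blockFactor_zero]
  let e : Fin S.card ≃o S := S.orderIsoOfFin rfl
  have hprod' : ∏ c ∈ S, firstForm n t c = ∏ i : Fin S.card, firstForm n t (e i) := by
    rw [← prod_coe_sort, ← Equiv.prod_comp e.toEquiv]; rfl
  have hμ : μ = ∑ i : Fin S.card, Finsupp.single (e i : ℕ) 1 := by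
    have h1 : ∑ i : Fin S.card, (Finsupp.single (e i : ℕ) 1 : ℕ →₀ ℕ)
        = ∑ c ∈ S, Finsupp.single c 1 := by
      rw [← sum_coe_sort S, ← Equiv.sum_comp e.toEquiv]; rfl
    rw [h1]
    conv_lhs => rw [← Finsupp.sum_single μ]
    exact sum_congr rfl fun c hc => by rw [hone c hc]
  rw [blockCoeff, hprod, hprod']
  simp only [firstForm_eq_sum_monomial]
  rw [prod_univ_sum, MvPolynomial.coeff_sum]
  simp only [prod_monomial, MvPolynomial.coeff_monomial]
  rw [← sum_filter, eulerianValue]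
  symm
  refine sum_bij (fun σ _ i => (e (σ.symm i) : ℕ)) ?_ ?_ ?_ ?_
  · intro σ _
    refine mem_filter.2 ⟨Fintype.mem_piFinset.2 fun i =>
      mem_range.2 (hn _ ((hmemS _).1 (e _).2)), ?_⟩
    rw [Equiv.sum_comp σ.symm (fun i => (Finsupp.single (e i : ℕ) 1 : ℕ →₀ ℕ)), ← hμ]
  · intro σ _ τ _ hστ
    have : σ.symm = τ.symm := by
      ext i
      exact congrArg Fin.val (e.injective (Subtype.ext (congrFun hστ i)))
    rw [← Equiv.symm_symm σ, this, Equiv.symm_symm]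
  · intro w hw
    obtain ⟨-, hw⟩ := mem_filter.1 hw
    have hcount : ∀ c, μ c = (univ.filter fun i => w i = c).card := by
      intro c
      rw [← hw, Finsupp.finsetSum_apply, card_filter]
      exact sum_congr rfl fun i _ => by rw [Finsupp.single_apply]
    have hwS : ∀ i, w i ∈ S := by
      intro i
      rw [hmemS, hcount]
      exact card_ne_zero_of_mem (mem_filter.2 ⟨mem_univ i, rfl⟩)
    have hinj : Function.Injective w := by
      intro i j hij
      have := h (w j)
      rw [hcount, card_le_one] at this
      exact this i (by simp [hij]) j (by simp)
    let f : Fin S.card → Fin S.card := fun i => e.symm ⟨w i, hwS i⟩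
    have hf : Function.Injective f := by
      intro i j hij
      exact hinj (congrArg Subtype.val (e.symm.injective hij))
    let τ : Equiv.Perm (Fin S.card) := Equiv.ofBijective f (Finite.injective_iff_bijective.1 hf)
    refine ⟨τ.symm, mem_univ _, ?_⟩
    funext i
    show (e (f i) : ℕ) = w i
    simp [f]
  · intro σ _
    rw [← Equiv.prod_comp σ]
    simp only [Equiv.symm_apply_apply]
    have hlt : ∀ i j, ((e i : ℕ) < (e j : ℕ)) ↔ i < j := fun i j => by
      rw [Subtype.coe_lt_coe]; exact e.lt_iff_lt
    simp only [hlt]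
    rw [prod_ite, prod_const, prod_const_one, mul_one]
    rfl

variable {K : Type*} [Field K]

/-- The polynomials `P_k(y)` with `∑ P_k(y) x^k = ((1 - t x) / (1 - x)) ^ (y / (1 - t))`, defined
by their three-term recurrence. -/
noncomputable def blockPoly (t : K) : ℕ → Polynomial K
  | 0 => 1
  | 1 => Polynomial.X
  | k + 2 => Polynomial.C ((k : K) + 2)⁻¹ *
      ((Polynomial.X + Polynomial.C ((1 + t) * (k + 1))) * blockPoly t (k + 1)
        - Polynomial.C (t * k) * blockPoly t k)

theorem blockPoly_add_two [CharZero K] (t : K) (k : ℕ) :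
    Polynomial.C ((k : K) + 2) * blockPoly t (k + 2)
      = Polynomial.X * blockPoly t (k + 1)
        + Polynomial.C ((1 + t) * (k + 1)) * blockPoly t (k + 1)
        - Polynomial.C (t * k) * blockPoly t k := by
  have h : (k : K) + 2 ≠ 0 := by exact_mod_cast (Nat.succ_ne_zero (k + 1))
  rw [blockPoly, ← mul_assoc, ← map_mul, mul_inv_cancel₀ h, map_one]
  ring

/-- The linear functional `y ^ k ↦ A_k(t)`. -/
noncomputable def umbral (t : K) : Polynomial K →ₗ[K] K :=
  Polynomial.lsum fun k => LinearMap.mulRight K (eulerianValue t k)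

theorem umbral_C_mul_X_pow (t a : K) (k : ℕ) :
    umbral t (Polynomial.C a * Polynomial.X ^ k) = a * eulerianValue t k := by
  rw [umbral, Polynomial.lsum_apply, Polynomial.C_mul_X_pow_eq_monomial,
    Polynomial.sum_monomial_index] <;> simp

theorem umbral_C_mul (t a : K) (p : Polynomial K) :
    umbral t (Polynomial.C a * p) = a * umbral t p := by
  rw [← Polynomial.smul_eq_C_mul, map_smul, smul_eq_mul]

/-- The block coefficient of a composition is the umbral value of the product of the polynomials
`P_k` over its parts. The hypothesis says that the block starting at `c` occupies the
positions `c, …, c + μ c - 1`. -/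
theorem blockCoeff_eq_umbral [CharZero K] {n : ℕ} (t : K) (μ : ℕ →₀ ℕ)
    (h : ∀ c, μ c ≠ 0 → c + μ c ≤ n ∧ ∀ a, c < a → a < c + μ c → μ a = 0) :
    blockCoeff n t μ = umbral t (∏ c ∈ range n, blockPoly t (μ c)) := by
  -- each splitting step lowers the product of the factorials of the block sizes
  induction hM : ∏ c ∈ range n, (μ c).factorial using Nat.strong_induction_on generalizing μ with
  | _ M ih =>
  by_cases hle : ∀ c, μ c ≤ 1
  · rw [blockCoeff_of_le_one t (fun c hc => by have := (h c hc).1; omega) hle]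
    have hsub : μ.support ⊆ range n := fun c hc => by
      have := (h c (Finsupp.mem_support_iff.1 hc)).1
      have := Finsupp.mem_support_iff.1 hc
      exact mem_range.2 (by omega)
    have : ∏ c ∈ range n, blockPoly t (μ c) = Polynomial.X ^ μ.support.card := by
      rw [← prod_subset hsub, prod_eq_pow_card]
      · intro c hc
        have h1 := hle c
        have h2 := Finsupp.mem_support_iff.1 hc
        rw [show μ c = 1 by omega, blockPoly]
      · intro c _ hc
        rw [Finsupp.notMem_support_iff.1 hc, blockPoly]
    rw [this, ← one_mul (Polynomial.X ^ _), ← Polynomial.C_1, umbral_C_mul_X_pow, one_mul]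
  · push Not at hle
    obtain ⟨c, hc2⟩ := hle
    obtain ⟨k, hk⟩ : ∃ k, μ c = k + 2 := ⟨μ c - 2, by omega⟩
    obtain ⟨hroom, hfree⟩ := h c (by omega)
    set ν := μ.erase c with hν
    have hμν : μ = ν + Finsupp.single c (k + 2) := by
      rw [hν, ← hk, Finsupp.erase_add_single]
    have hνc : ν c = 0 := Finsupp.erase_same
    have hνne : ∀ b, b ≠ c → ν b = μ b := fun b hb => Finsupp.erase_ne hb
    have hcn : c < n := by omega
    have hc' : c + (k + 1) < n := by omega
    have hνzero : ∀ a, c ≤ a → a ≤ c + (k + 1) → ν a = 0 := by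
      intro a h1 h2
      rcases h1.eq_or_lt with rfl | h1
      · exact hνc
      · rw [hνne a h1.ne', hfree a h1 (by omega)]
    have hrel := blockCoeff_split t (Nat.lt_add_of_pos_right (Nat.succ_pos k)) hc' hνzero k
    have hν1 : ∀ j : ℕ, (ν + Finsupp.single c j) (c + (k + 1)) = 0 := by
      intro j
      simp [hνzero (c + (k + 1)) (by omega) le_rfl]
    have hfact : ∀ j : ℕ, ∏ b ∈ range n, ((ν + Finsupp.single c j) b).factorial
        = (∏ b ∈ range n, (ν b).factorial) * j.factorial := fun j =>
      prod_apply_add_single (fun _ k => k.factorial) (fun _ => rfl) hcn hνc j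
    have hpos : 0 < ∏ b ∈ range n, (ν b).factorial :=
      prod_pos fun b _ => Nat.factorial_pos _
    have hpoly : ∀ j, ∏ b ∈ range n, blockPoly t ((ν + Finsupp.single c j) b)
        = (∏ b ∈ range n, blockPoly t (ν b)) * blockPoly t j := fun j =>
      prod_apply_add_single (fun _ => blockPoly t) (fun _ => by rw [blockPoly]) hcn hνc j
    have hMeq : M = (∏ b ∈ range n, (ν b).factorial) * (k + 2).factorial := by
      rw [← hM, ← hfact, ← hμν]
    have hdiff : ∀ b, b ≠ c → μ b ≠ 0 → c < b + μ b → c < b := by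
      intro b hb hb0 hlt
      by_contra hcb
      have := (h b hb0).2 c (by omega) hlt
      omega
    have hval : ∀ j b : ℕ, (ν + Finsupp.single c j) b = if b = c then j else μ b := by
      intro j b
      split_ifs with hb
      · rw [hb]; simp [hνc]
      · simp [hνne b hb, hb]
    have ihj : ∀ j, j ≤ k + 1 → blockCoeff n t (ν + Finsupp.single c j)
        = umbral t ((∏ b ∈ range n, blockPoly t (ν b)) * blockPoly t j) := by
      intro j hj
      rw [← hpoly]
      refine ih _ ?_ _ ?_ rfl
      · rw [hfact, hMeq]
        exact Nat.mul_lt_mul_of_pos_left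
          ((Nat.factorial_le hj).trans_lt (Nat.factorial_lt_of_lt (by omega) (by omega))) hpos
      · intro b
        simp only [hval]
        intro hb
        split_ifs at hb ⊢ with hbc
        · subst hbc
          refine ⟨by omega, fun a h1 h2 => ?_⟩
          rw [if_neg h1.ne']; exact hfree a h1 (by omega)
        · refine ⟨(h b hb).1, fun a h1 h2 => ?_⟩
          have := hdiff b hbc hb
          rw [if_neg (by omega)]; exact (h b hb).2 a h1 h2
    have ih1 : blockCoeff n t (ν + Finsupp.single c (k + 1) + Finsupp.single (c + (k + 1)) 1)
        = umbral t ((∏ b ∈ range n, blockPoly t (ν b)) * blockPoly t (k + 1)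
            * blockPoly t 1) := by
      rw [← hpoly, ← prod_apply_add_single (fun _ => blockPoly t) (fun _ => by rw [blockPoly]) hc'
        (hν1 _) 1]
      refine ih _ ?_ _ ?_ rfl
      · rw [prod_apply_add_single (fun _ k => k.factorial) (fun _ => rfl) hc' (hν1 _) 1, hfact,
          hMeq, Nat.factorial_one, mul_one]
        exact Nat.mul_lt_mul_of_pos_left (Nat.factorial_lt_of_lt (by omega) (by omega)) hpos
      · have hval' : ∀ b : ℕ,
            (ν + Finsupp.single c (k + 1) + Finsupp.single (c + (k + 1)) 1 : ℕ →₀ ℕ) b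
            = if b = c then k + 1 else if b = c + (k + 1) then 1 else μ b := by
          intro b
          rw [Finsupp.add_apply, hval]
          split_ifs with h1 h2
          · subst h1; simp
          · subst h2; simp [hfree (c + (k + 1)) (by omega) (by omega)]
          · simp [h2]
        intro b
        simp only [hval']
        intro hb
        split_ifs at hb ⊢ with hbc hbc'
        · subst hbc
          refine ⟨by omega, fun a h1 h2 => ?_⟩
          rw [if_neg h1.ne', if_neg (by omega)]; exact hfree a h1 (by omega)
        · exact ⟨by omega, fun a h1 h2 => by omega⟩
        · refine ⟨(h b hb).1, fun a h1 h2 => ?_⟩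
          have h3 := hdiff b hbc hb
          have h4 := hfree b
          rw [if_neg (by omega), if_neg (by omega)]; exact (h b hb).2 a h1 h2
    have hk0 : (k : K) + 2 ≠ 0 := by exact_mod_cast (Nat.succ_ne_zero (k + 1))
    refine mul_left_cancel₀ hk0 ?_
    set Q := ∏ b ∈ range n, blockPoly t (ν b)
    have hB : ((k : K) + 2) * umbral t (Q * blockPoly t (k + 2))
        = umbral t (Q * (blockPoly t 1 * blockPoly t (k + 1)))
          + (1 + t) * (k + 1) * umbral t (Q * blockPoly t (k + 1))
          - t * k * umbral t (Q * blockPoly t k) := by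
      rw [← umbral_C_mul, ← umbral_C_mul, ← umbral_C_mul, ← map_add, ← map_sub, mul_left_comm,
        blockPoly_add_two, show blockPoly t 1 = Polynomial.X by rw [blockPoly]]
      congr 1
      ring
    rw [hμν, hrel, ihj _ le_rfl, ihj _ (by omega), ih1, hpoly, hB, mul_assoc,
      mul_comm (blockPoly t 1)]

end Umbral

/-! ### Summation over the cut sets -/

section Cuts

theorem blockSizes_occupies (T : Finset ℕ) (n c : ℕ) (hc : blockSizes T n c ≠ 0) :
    c + blockSizes T n c ≤ n ∧
      ∀ a, c < a → a < c + blockSizes T n c → blockSizes T n a = 0 := by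
  have hidem : ∀ b, blockSizes T n b ≠ 0 → blockStart T b = b := by
    intro b hb
    rw [blockSizes_apply] at hb
    obtain ⟨v, hv⟩ := card_pos.1 (Nat.pos_of_ne_zero hb)
    rw [← (mem_filter.1 hv).2, blockStart_idem]
  have hcc := hidem c hc
  have hle : ∀ v ∈ (range n).filter fun v => blockStart T v = c, c ≤ v := fun v hv =>
    (mem_filter.1 hv).2 ▸ blockStart_le T v
  have hcn : c < n := by
    rw [blockSizes_apply] at hc
    obtain ⟨v, hv⟩ := card_pos.1 (Nat.pos_of_ne_zero hc)
    exact (hle v hv).trans_lt (mem_range.1 (mem_filter.1 hv).1)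
  have hcard : ∀ b, c ≤ b → (∀ v ∈ (range n).filter fun v => blockStart T v = c, v < b) →
      c + blockSizes T n c ≤ b := by
    intro b hcb hb
    have : ((range n).filter fun v => blockStart T v = c) ⊆ Ico c b := fun v hv =>
      mem_Ico.2 ⟨hle v hv, hb v hv⟩
    have := card_le_card this
    rw [Nat.card_Ico] at this
    rw [blockSizes_apply]
    omega
  refine ⟨hcard n hcn.le fun v hv => mem_range.1 (mem_filter.1 hv).1, fun a hca ha => ?_⟩
  by_contra hne
  have haa := hidem a hne
  refine absurd (hcard a hca.le fun v hv => ?_) (not_le.2 ha)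
  by_contra hva
  have := blockStart_mono T (not_lt.1 hva)
  rw [haa, (mem_filter.1 hv).2] at this
  omega

theorem blockSizes_eq_zero (T : Finset ℕ) {n c : ℕ} (h : n ≤ c) : blockSizes T n c = 0 := by
  rw [blockSizes_apply, card_eq_zero, filter_eq_empty_iff]
  intro v hv
  exact ((blockStart_le T v).trans_lt ((mem_range.1 hv).trans_le h)).ne

theorem blockSizes_empty (n : ℕ) : blockSizes ∅ n = Finsupp.single 0 n := by
  simp [blockSizes, blockStart, Finsupp.smul_single]

theorem blockSizes_insert {T : Finset ℕ} {n : ℕ} (hT : T ⊆ Ico 1 n) (j : ℕ) :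
    blockSizes (insert n T) (n + (j + 1)) = blockSizes T n + Finsupp.single n (j + 1) := by
  rw [blockSizes, sum_range_add, blockSizes]
  congr 1
  · refine sum_congr rfl fun i hi => ?_
    rw [blockStart, filter_insert, if_neg (not_le.2 (mem_range.1 hi)), blockStart]
  · have h : ∀ i ∈ range (j + 1),
        (Finsupp.single (blockStart (insert n T) (n + i)) 1 : ℕ →₀ ℕ) = Finsupp.single n 1 := by
      intro i _
      congr 1
      refine le_antisymm (Finset.sup_le fun p hp => ?_)
        (Finset.le_sup (f := id) (mem_filter.2 ⟨mem_insert_self n T, Nat.le_add_right n i⟩))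
      rcases mem_insert.1 (mem_filter.1 hp).1 with rfl | hp
      · exact le_rfl
      · exact (mem_Ico.1 (hT hp)).2.le
    rw [sum_congr rfl h, sum_const, card_range, Finsupp.smul_single, smul_eq_mul, mul_one]

variable {K : Type*} [Field K]

/-- The product of the block polynomials over all blocks of `{0, …, n - 1}`. -/
noncomputable def blockPolyProd (t : K) (T : Finset ℕ) (n : ℕ) : Polynomial K :=
  ∏ c ∈ range n, blockPoly t (blockSizes T n c)

theorem blockPoly_zero (t : K) : blockPoly t 0 = 1 := by rw [blockPoly]

theorem blockPolyProd_empty (t : K) (n : ℕ) : blockPolyProd t ∅ n = blockPoly t n := by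
  rw [blockPolyProd, blockSizes_empty]
  cases n with
  | zero => rw [range_zero, prod_empty, blockPoly_zero]
  | succ n =>
    rw [prod_eq_single 0]
    · rw [Finsupp.single_eq_same]
    · intro b _ hb; rw [Finsupp.single_eq_of_ne hb, blockPoly_zero]
    · intro h; simp at h

theorem blockPolyProd_insert (t : K) {T : Finset ℕ} {n : ℕ} (hT : T ⊆ Ico 1 n) (j : ℕ) :
    blockPolyProd t (insert n T) (n + (j + 1)) = blockPolyProd t T n * blockPoly t (j + 1) := by
  rw [blockPolyProd, blockSizes_insert hT,
    prod_apply_add_single (fun _ => blockPoly t) (fun _ => blockPoly_zero t) (by omega)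
      (blockSizes_eq_zero T le_rfl), prod_range_add, blockPolyProd]
  have h : ∏ i ∈ range (j + 1), blockPoly t (blockSizes T n (n + i)) = 1 :=
    prod_eq_one fun i _ => by rw [blockSizes_eq_zero T (Nat.le_add_right n i), blockPoly_zero]
  rw [h, mul_one]

/-- The weighted sum over the cut sets `T ⊆ {1, …, n - 1}` of the products of block polynomials,
the last block being prolonged by `j`, in recursive form: the position `n` is a cut
with weight `q ^ n`, and no cut with weight `1 - q ^ n`. The weights at `n = 0` are `1` and `0`,
so the values `cutPoly q t 0 j` with `j > 0` do not enter the later ones. -/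
noncomputable def cutPoly (q t : K) : ℕ → ℕ → Polynomial K
  | 0, j => blockPoly t j
  | n + 1, j => Polynomial.C (1 - q ^ n) * cutPoly q t n (j + 1)
      + Polynomial.C (q ^ n) * (cutPoly q t n 0 * blockPoly t (j + 1))

theorem cutPoly_zero_zero (q t : K) : cutPoly q t 0 0 = 1 := by rw [cutPoly, blockPoly_zero]

theorem cutPoly_succ (q t : K) (n j : ℕ) : cutPoly q t (n + 1) j =
    Polynomial.C (1 - q ^ n) * cutPoly q t n (j + 1)
      + Polynomial.C (q ^ n) * (cutPoly q t n 0 * blockPoly t (j + 1)) := by rw [cutPoly]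

theorem sum_cuts_eq_cutPoly (q t : K) {n : ℕ} (hn : 1 ≤ n) (j : ℕ) :
    ∑ T ∈ (Ico 1 n).powerset,
        Polynomial.C ((∏ p ∈ T, q ^ p) * ∏ p ∈ Ico 1 n \ T, (1 - q ^ p))
          * blockPolyProd t T (n + j)
      = cutPoly q t n j := by
  induction n, hn using Nat.le_induction generalizing j with
  | base =>
    rw [cutPoly_succ, cutPoly_zero_zero]
    simp [blockPolyProd_empty, add_comm 1 j]
  | succ n hn ih =>
    have hI : Ico 1 (n + 1) = insert n (Ico 1 n) := by
      ext p
      simp only [mem_Ico, mem_insert]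
      omega
    have hnot : n ∉ Ico 1 n := by simp
    rw [hI, sum_powerset_insert hnot, cutPoly_succ, ← ih, ← ih, mul_sum, sum_mul, mul_sum]
    refine congrArg₂ (· + ·) (sum_congr rfl fun T hT => ?_) (sum_congr rfl fun T hT => ?_)
    · have hnT : n ∉ T := fun h => hnot (mem_powerset.1 hT h)
      rw [insert_sdiff_of_notMem _ hnT, prod_insert (fun h => hnot (mem_sdiff.1 h).1),
        add_right_comm, add_assoc, mul_left_comm, Polynomial.C_mul, mul_assoc]
    · have hnT : n ∉ T := fun h => hnot (mem_powerset.1 hT h)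
      have hs : insert n (Ico 1 n) \ insert n T = Ico 1 n \ T := by
        rw [insert_sdiff_insert, sdiff_insert_of_notMem hnot]
      rw [hs, prod_insert hnT, add_right_comm, add_assoc,
        blockPolyProd_insert t (mem_powerset.1 hT), add_zero, mul_assoc (q ^ n), Polynomial.C_mul,
        mul_assoc, mul_assoc]

theorem sum_maj_exc_eq_umbral [CharZero K] (m : ℕ) (q t : K) (hq : q ≠ 0) :
    ∑ σ : Equiv.Perm (Fin (m + 1)), q ^ maj σ * (t * q⁻¹) ^ exc σ
      = umbral t (cutPoly q t (m + 1) 0) := by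
  rw [sum_maj_exc_eq m q t hq, ← sum_cuts_eq_cutPoly q t (Nat.le_add_left 1 m), map_sum]
  refine sum_congr rfl fun T _ => ?_
  rw [umbral_C_mul, excSum_eq_blockCoeff, blockCoeff_eq_umbral t _ (blockSizes_occupies T (m + 1)),
    add_zero, blockPolyProd]

/-- Unfolding of the recursion according to the start `a` of the last block. -/
theorem cutPoly_eq_sum (q t : K) {n : ℕ} (hn : 1 ≤ n) (j : ℕ) :
    cutPoly q t n j = ∑ a ∈ range n, Polynomial.C (q ^ a * ∏ p ∈ Ico (a + 1) n, (1 - q ^ p))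
      * (cutPoly q t a 0 * blockPoly t (n + j - a)) := by
  induction n, hn using Nat.le_induction generalizing j with
  | base => rw [cutPoly_succ]; simp [add_comm 1 j]
  | succ n hn ih =>
    rw [cutPoly_succ, sum_range_succ, ih, mul_sum]
    refine congrArg₂ (· + ·) (sum_congr rfl fun a ha => ?_) ?_
    · rw [prod_Ico_succ_top (mem_range.1 ha), ← mul_assoc, ← Polynomial.C_mul,
        show n + (j + 1) - a = n + 1 + j - a by omega, ← mul_assoc (q ^ a), mul_comm (1 - q ^ n)]
    · rw [Ico_self, prod_empty, mul_one, show n + 1 + j - n = j + 1 by omega]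

/-- At a `d`-th root of unity every multiple of `d` is a cut. -/
theorem cutPoly_mul_add (q t : K) {d : ℕ} (hq : q ^ d = 1) (k n j : ℕ) :
    cutPoly q t (d * k + (n + 1)) j = cutPoly q t (d * k) 0 * cutPoly q t (n + 1) j := by
  have hpow : ∀ n, q ^ (d * k + n) = q ^ n := fun n => by
    rw [pow_add, pow_mul, hq, one_pow, one_mul]
  induction n generalizing j with
  | zero =>
    rw [zero_add, cutPoly_succ, cutPoly_succ, cutPoly_zero_zero, ← add_zero (d * k), hpow, add_zero]
    simp
  | succ n ih =>
    rw [← add_assoc (d * k), cutPoly_succ, cutPoly_succ q t (n + 1), ih, ih, hpow]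
    ring

theorem cutPoly_mul (q t : K) {d : ℕ} (hd : 0 < d) (hq : q ^ d = 1) (k : ℕ) :
    cutPoly q t (d * k) 0 = cutPoly q t d 0 ^ k := by
  obtain ⟨e, rfl⟩ : ∃ e, d = e + 1 := ⟨d - 1, by omega⟩
  induction k with
  | zero => rw [mul_zero, cutPoly_zero_zero, pow_zero]
  | succ k ih => rw [mul_add, mul_one, cutPoly_mul_add q t hq, ih, pow_succ]

end Cuts

/-! ### Logarithmic derivatives of power series -/

section LogDerivative

open PowerSeries

variable {A : Type*} [CommRing A]

/-- The derivation `x d/dx`. -/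
noncomputable def eulerDeriv (f : PowerSeries A) : PowerSeries A := X * derivative A f

theorem coeff_eulerDeriv (n : ℕ) (f : PowerSeries A) :
    coeff n (eulerDeriv f) = n * coeff n f := by
  cases n with
  | zero => simp [eulerDeriv]
  | succ n => rw [eulerDeriv, coeff_succ_X_mul, coeff_derivative]; push_cast; ring

theorem eulerDeriv_mul (f g : PowerSeries A) :
    eulerDeriv (f * g) = f * eulerDeriv g + g * eulerDeriv f := by
  rw [eulerDeriv, Derivation.leibniz, smul_eq_mul, smul_eq_mul, eulerDeriv, eulerDeriv]; ring

theorem eulerDeriv_rescale (q : A) (f : PowerSeries A) :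
    eulerDeriv (rescale q f) = rescale q (eulerDeriv f) := by
  ext n
  rw [coeff_eulerDeriv, coeff_rescale, coeff_rescale, coeff_eulerDeriv]; ring

/-- Let `x P' = ψ P` with `ψ(0) = 0`, and let `P(x) G(q x)` agree with `G(x)` below degree `d`,
where `G(0) = 1` and `q ^ d = 1`. Comparing logarithmic derivatives, in which the contributions of
`G(q x)` and `G(x)` to degree `d` cancel, gives the discrepancy in degree `d`. -/
theorem coeff_mul_rescale_sub (q : A) {d : ℕ} (hq : q ^ d = 1) {P G ψ : PowerSeries A}
    (hP : eulerDeriv P = ψ * P) (hψ : coeff 0 ψ = 0) (hG : constantCoeff G = 1)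
    (h : ∀ n < d, coeff n (P * rescale q G) = coeff n G) :
    (d : A) * (coeff d (P * rescale q G) - coeff d G) = coeff d ψ := by
  set H := P * rescale q G with hH
  obtain ⟨I, hI⟩ : ∃ I, G * I = 1 := ⟨invOfUnit G 1, mul_invOfUnit G 1 (by simp [hG])⟩
  have hI0 : constantCoeff I = 1 := by
    have := congrArg constantCoeff hI
    rwa [map_mul, hG, one_mul, map_one] at this
  obtain ⟨W, hW⟩ : X ^ d ∣ H - G := X_pow_dvd_iff.2 fun n hn => by
    rw [map_sub, h n hn, sub_self]
  set Y := W * I with hY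
  set U := 1 + X ^ d * Y with hU
  obtain ⟨l, hlG⟩ : ∃ l, eulerDeriv G = l * G :=
    ⟨eulerDeriv G * I, by rw [mul_assoc, mul_comm I, hI, mul_one]⟩
  have hHU : H = G * U := by
    rw [hU, hY, mul_add, mul_one, mul_left_comm, mul_left_comm G, hI, mul_one, ← hW]; ring
  have hH1 : eulerDeriv H = (ψ + rescale q l) * H := by
    rw [hH, eulerDeriv_mul, eulerDeriv_rescale, hlG, map_mul, hP]; ring
  have hH2 : eulerDeriv H = l * H + G * eulerDeriv U := by
    rw [hHU, eulerDeriv_mul, hlG]; ring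
  have hkey : (ψ + rescale q l - l) * U = eulerDeriv U := by
    have h1 : G * ((ψ + rescale q l - l) * U) = G * eulerDeriv U := by
      have : (ψ + rescale q l) * H = l * H + G * eulerDeriv U := hH1.symm.trans hH2
      rw [hHU] at this
      linear_combination this
    have h2 := congrArg (I * ·) h1
    simpa only [← mul_assoc, mul_comm I G, hI, one_mul] using h2
  have hcoeffU : ∀ Z : PowerSeries A, coeff d (X ^ d * Z) = constantCoeff Z := by
    intro Z
    have := coeff_X_pow_mul Z d 0
    rwa [zero_add, coeff_zero_eq_constantCoeff_apply] at this
  have h0 : constantCoeff (ψ + rescale q l - l) = 0 := by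
    rw [← coeff_zero_eq_constantCoeff_apply, map_sub, map_add, coeff_rescale, hψ]; ring
  have hc := congrArg (coeff d) hkey
  rw [coeff_eulerDeriv, hU, mul_add, mul_one, mul_left_comm, map_add, map_add, hcoeffU, hcoeffU,
    constantCoeff.map_mul, h0, map_sub, map_add, coeff_rescale, hq] at hc
  have hY0 : constantCoeff Y = coeff d H - coeff d G := by
    rw [← map_sub, hW, hcoeffU, hY, map_mul, hI0, mul_one]
  have h1 : (d : A) * coeff d (1 : PowerSeries A) = 0 := by
    rw [coeff_one]; split_ifs with hd0 <;> simp [hd0]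
  rw [← hY0]
  linear_combination -h1 - hc

end LogDerivative

/-! ### Evaluation at a root of unity -/

section RootOfUnity

variable {K : Type*} [Field K]

theorem qNumber_succ (t : K) (m : ℕ) : qNumber (m + 1) t = qNumber m t + t ^ m := sum_range_succ _ _

theorem qNumber_add_two (t : K) (m : ℕ) :
    qNumber (m + 2) t - (1 + t) * qNumber (m + 1) t + t * qNumber m t = 0 := by
  rw [qNumber_succ, qNumber_succ, pow_succ]; ring

/-- `x P'(x) = y ∑ [m]_t x^m ⋅ P(x)` for the generating function `P` of the block polynomials. -/
theorem eulerDeriv_mk_blockPoly [CharZero K] (t : K) :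
    eulerDeriv (PowerSeries.mk (blockPoly t))
      = PowerSeries.mk (fun m => Polynomial.C (qNumber m t) * Polynomial.X)
        * PowerSeries.mk (blockPoly t) := by
  set s : Polynomial K := Polynomial.C t with hs
  set ψ : PowerSeries (Polynomial K) :=
    PowerSeries.mk (fun m => Polynomial.C (qNumber m t) * Polynomial.X) with hψ
  set P := PowerSeries.mk (blockPoly t) with hP
  -- multiplication by `(1 - x) (1 - t x)` turns both sides into `x y P`
  set D : PowerSeries (Polynomial K) := 1 - PowerSeries.C (1 + s) * PowerSeries.X
    + PowerSeries.C s * (PowerSeries.X * PowerSeries.X) with hD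
  have hmul : ∀ f : PowerSeries (Polynomial K), D * f = f
      - PowerSeries.C (1 + s) * (PowerSeries.X * f)
      + PowerSeries.C s * (PowerSeries.X * (PowerSeries.X * f)) := by
    intro f; rw [hD]; ring
  have h0 : ∀ f : PowerSeries (Polynomial K),
      PowerSeries.coeff 0 (D * f) = PowerSeries.coeff 0 f := by
    intro f; rw [hmul]; simp
  have h1 : ∀ f : PowerSeries (Polynomial K), PowerSeries.coeff 1 (D * f)
      = PowerSeries.coeff 1 f - (1 + s) * PowerSeries.coeff 0 f := by
    intro f
    rw [hmul, map_add, map_sub, PowerSeries.coeff_C_mul, PowerSeries.coeff_C_mul,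
      PowerSeries.coeff_succ_X_mul 0, PowerSeries.coeff_succ_X_mul 0,
      PowerSeries.coeff_zero_X_mul, mul_zero, add_zero]
  have h2 : ∀ (f : PowerSeries (Polynomial K)) (n : ℕ), PowerSeries.coeff (n + 2) (D * f)
      = PowerSeries.coeff (n + 2) f - (1 + s) * PowerSeries.coeff (n + 1) f
        + s * PowerSeries.coeff n f := by
    intro f n
    rw [hmul, map_add, map_sub, PowerSeries.coeff_C_mul, PowerSeries.coeff_C_mul,
      PowerSeries.coeff_succ_X_mul (n + 1), PowerSeries.coeff_succ_X_mul (n + 1),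
      PowerSeries.coeff_succ_X_mul]
  have hDψ : D * ψ = PowerSeries.X * PowerSeries.C Polynomial.X := by
    ext1 n
    match n with
    | 0 => rw [h0, PowerSeries.coeff_zero_X_mul]; simp [hψ, qNumber]
    | 1 =>
      rw [h1, PowerSeries.coeff_succ_X_mul 0]
      simp [hψ, qNumber]
    | n + 2 =>
      rw [h2, PowerSeries.coeff_succ_X_mul (n + 1), PowerSeries.coeff_C,
        if_neg (Nat.succ_ne_zero n)]
      simp only [hψ, PowerSeries.coeff_mk]
      have := congrArg Polynomial.C (qNumber_add_two t n)
      simp only [map_add, map_sub, map_mul, map_one, map_zero] at this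
      linear_combination Polynomial.X * this
  have hDP : D * eulerDeriv P = PowerSeries.X * (PowerSeries.C Polynomial.X * P) := by
    ext1 n
    match n with
    | 0 => rw [h0, PowerSeries.coeff_zero_X_mul, coeff_eulerDeriv]; simp
    | 1 =>
      rw [h1, PowerSeries.coeff_succ_X_mul 0, PowerSeries.coeff_C_mul, coeff_eulerDeriv,
        coeff_eulerDeriv]
      simp [hP, blockPoly]
    | n + 2 =>
      rw [h2, PowerSeries.coeff_succ_X_mul (n + 1), PowerSeries.coeff_C_mul, coeff_eulerDeriv,
        coeff_eulerDeriv, coeff_eulerDeriv]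
      simp only [hP, PowerSeries.coeff_mk]
      have := blockPoly_add_two t n
      simp only [map_add, map_mul, map_one, map_natCast, map_ofNat] at this
      push_cast
      linear_combination this
  have hD0 : D ≠ 0 := by
    intro h
    have := h0 1
    rw [h, zero_mul] at this
    simp at this
  refine mul_left_cancel₀ hD0 ?_
  rw [hDP, ← mul_assoc D, hDψ, mul_assoc]

/-- At a primitive `d`-th root of unity the sum over all cuttings of a block of
length `d` collapses to `[d]_t y`. -/
theorem cutPoly_of_isPrimitiveRoot [CharZero K] (q t : K) {d : ℕ} (hd : 0 < d)
    (hq : IsPrimitiveRoot q d) :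
    cutPoly q t d 0 = Polynomial.C (qNumber d t) * Polynomial.X := by
  set φ : ℕ → K := fun a => ∏ k ∈ range a, (1 - q ^ (k + 1)) with hφ
  have hφ0 : ∀ a < d, φ a ≠ 0 := by
    intro a ha
    refine prod_ne_zero_iff.2 fun k hk => sub_ne_zero.2 fun h => ?_
    have h1 := mem_range.1 hk
    exact hq.pow_ne_one_of_pos_of_lt (Nat.succ_ne_zero k) (by omega) h.symm
  have hφd : ∀ e, d = e + 1 → φ e = d := by
    rintro e rfl
    rw [hφ]
    simp only
    rw [hq.prod_one_sub_pow_eq_order]; push_cast; rfl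
  have hφIco : ∀ a n, a ≤ n → (∏ p ∈ Ico (a + 1) (n + 1), (1 - q ^ p)) * φ a = φ n := by
    intro a n han
    rw [mul_comm, hφ, ← prod_Ico_add' (fun p => 1 - q ^ p)]
    exact prod_range_mul_prod_Ico _ han
  set g : ℕ → Polynomial K := fun a =>
    if a < d then Polynomial.C (φ a)⁻¹ * cutPoly q t a 0 else 0 with hg
  -- `r n` is `cutPoly q t n 0` without the factor `φ (n - 1)`, expanded by the last block
  set r : ℕ → Polynomial K := fun n =>
    ∑ a ∈ range n, Polynomial.C q ^ a * g a * blockPoly t (n - a) with hr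
  have hcut : ∀ n, n + 1 ≤ d → cutPoly q t (n + 1) 0 = Polynomial.C (φ n) * r (n + 1) := by
    intro n hn
    rw [cutPoly_eq_sum q t (Nat.le_add_left 1 n), hr, mul_sum]
    refine sum_congr rfl fun a ha => ?_
    have ha' := mem_range.1 ha
    have h1 : Polynomial.C (φ a) * Polynomial.C (φ a)⁻¹ = 1 := by
      rw [← Polynomial.C_mul, mul_inv_cancel₀ (hφ0 a (by omega)), Polynomial.C_1]
    rw [← hφIco a n (by omega), add_zero, hg]
    simp only
    rw [if_pos (by omega), Polynomial.C_mul, Polynomial.C_mul, Polynomial.C_pow]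
    linear_combination -(Polynomial.C q ^ a * Polynomial.C (∏ p ∈ Ico (a + 1) (n + 1), (1 - q ^ p))
      * cutPoly q t a 0 * blockPoly t (n + 1 - a)) * h1
  have hcoeff : ∀ n, PowerSeries.coeff n (PowerSeries.mk (blockPoly t)
        * PowerSeries.rescale (Polynomial.C q) (PowerSeries.mk g))
      = r n + Polynomial.C q ^ n * g n := by
    intro n
    rw [mul_comm, PowerSeries.coeff_mul, Nat.sum_antidiagonal_eq_sum_range_succ_mk, sum_range_succ]
    simp [hr, PowerSeries.coeff_rescale, blockPoly_zero]
  have hlow : ∀ n < d, r n + Polynomial.C q ^ n * g n = g n := by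
    intro n hn
    cases n with
    | zero => simp [hr]
    | succ n =>
      have h1 : φ (n + 1) = φ n * (1 - q ^ (n + 1)) := prod_range_succ _ _
      have h2 : φ n ≠ 0 := hφ0 n (by omega)
      have h3 : φ (n + 1) ≠ 0 := hφ0 _ hn
      have h4 : g (n + 1) = Polynomial.C ((φ (n + 1))⁻¹ * φ n) * r (n + 1) := by
        rw [hg]; simp only
        rw [if_pos hn, hcut n hn.le, Polynomial.C_mul, mul_assoc]
      have h5 : (1 - q ^ (n + 1)) * ((φ (n + 1))⁻¹ * φ n) = 1 := by
        rw [mul_comm (1 - _), mul_assoc, ← h1, inv_mul_cancel₀ h3]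
      have h6 : Polynomial.C (1 - q ^ (n + 1)) * g (n + 1) = r (n + 1) := by
        rw [h4, ← mul_assoc, ← Polynomial.C_mul, h5, Polynomial.C_1, one_mul]
      rw [← h6, Polynomial.C_sub, Polynomial.C_pow, Polynomial.C_1]
      ring
  have hmain := coeff_mul_rescale_sub (Polynomial.C q) (d := d)
    (by rw [← Polynomial.C_pow, hq.pow_eq_one, Polynomial.C_1])
    (G := PowerSeries.mk g) (eulerDeriv_mk_blockPoly t) (by simp [qNumber])
    (by
      rw [← PowerSeries.coeff_zero_eq_constantCoeff_apply, PowerSeries.coeff_mk, hg]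
      simp [hd, hφ, cutPoly_zero_zero])
    (fun n hn => by rw [hcoeff, PowerSeries.coeff_mk, hlow n hn])
  have hgd : g d = 0 := if_neg (lt_irrefl d)
  rw [hcoeff, PowerSeries.coeff_mk, PowerSeries.coeff_mk, hgd, mul_zero, add_zero,
    sub_zero] at hmain
  obtain ⟨e, he⟩ : ∃ e, d = e + 1 := ⟨d - 1, by omega⟩
  rw [← hmain]
  conv_lhs => rw [he, hcut e he.ge, hφd e he, ← he, map_natCast]

end RootOfUnity

end QEulerian

theorem corollary6p2 (n d k : ℕ) (hd : 0 < d) (hn : d * k = n)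
    (ω : ℂ) (hω : IsPrimitiveRoot ω d) :
    MvPolynomial.aeval
        (![Polynomial.C ω, Polynomial.X * Polynomial.C ω⁻¹] : Fin 2 → Polynomial ℂ)
        (QEulerian.majExcPolynomial n) =
      (QEulerian.eulerianPolynomial k).map (Int.castRingHom ℂ) *
        QEulerian.qNumber d (Polynomial.X : Polynomial ℂ) ^ k := by
  refine Polynomial.funext fun t => ?_
  have hL : Polynomial.eval t (MvPolynomial.aeval
        (![Polynomial.C ω, Polynomial.X * Polynomial.C ω⁻¹] : Fin 2 → Polynomial ℂ)
        (QEulerian.majExcPolynomial n))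
      = ∑ σ : Equiv.Perm (Fin n), ω ^ QEulerian.maj σ * (t * ω⁻¹) ^ QEulerian.exc σ := by
    simp [QEulerian.majExcPolynomial, Polynomial.eval_finsetSum, mul_comm t]
  have hR : Polynomial.eval t ((QEulerian.eulerianPolynomial k).map (Int.castRingHom ℂ) *
        QEulerian.qNumber d (Polynomial.X : Polynomial ℂ) ^ k)
      = QEulerian.qNumber d t ^ k * QEulerian.eulerianValue t k := by
    simp [QEulerian.eulerianPolynomial, QEulerian.eulerianValue, QEulerian.qNumber,
      Polynomial.eval_finsetSum, Polynomial.map_sum, mul_comm]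
  rw [hL, hR]
  cases n with
  | zero =>
    obtain rfl : k = 0 := (Nat.mul_eq_zero.1 hn).resolve_left hd.ne'
    simp [QEulerian.eulerianValue, QEulerian.maj, QEulerian.exc, QEulerian.desSet,
      QEulerian.excSet]
  | succ m =>
    rw [QEulerian.sum_maj_exc_eq_umbral m ω t (hω.ne_zero hd.ne'), ← hn,
      QEulerian.cutPoly_mul ω t hd hω.pow_eq_one, QEulerian.cutPoly_of_isPrimitiveRoot ω t hd hω,
      mul_pow, ← Polynomial.C_pow, QEulerian.umbral_C_mul_X_pow]
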